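/- **Setting.** Let $h$ be a probability density on $\mathbb R$ with mean $0$ and finite positive second moment, $f_0$ a probability density (the null hypothesis), and $d\ge 1$ an integer. For $1\le k\le d$ let $\{f^{(k)}_\theta:\theta\in\Theta_k\}$, $\Theta_k\subseteq\mathbb R^k$, be a family of probability densities with $0\in\Theta_k$ and $f^{(k)}_0=f_0$ a.e.; derivatives relative to $\Theta_k$ are assumed to be unique at each of its points (for instance, $\Theta_k$ is open). The families are nested: identifying $\theta\in\mathbb R^k$ with $(\theta,0)\in\mathbb R^l$ for $k\le l\le d$, one has $\Theta_k\subseteq\Theta_l$ and $f^{(l)}_{(\theta,0)}=f^{(k)}_\theta$ a.e. for $\theta\in\Theta_k$. Put $$q_k(y;\theta)=\int f^{(k)}_\theta(s)\,h(y-s)\,ds,\qquad dQ_{k,\theta}(y)=q_k(y;\theta)\,dy,\qquad \dot l_k(y;\theta)=\frac{\nabla_\theta\, q_k(y;\theta)}{q_k(y;\theta)}\,1_{[q_k(y;\theta)>0]},$$ and $I_k(\theta)=\int \dot l_k\dot l_k^{T}\,dQ_{k,\theta}$. Assume that every one of these families gives a regular deconvolution problem: for every $\theta\in\Theta_k$ the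 function $q_k(y;\cdot)$ is continuously differentiable at $\theta$ for Lebesgue-almost all $y$; $|\dot l_k(\cdot;\theta)|\in L_2(Q_{k,\theta})$; and $I_k(\theta)$ is nonsingular, and continuous in $\theta\in\Theta_k$. Let $F$ be a probability distribution on $\mathbb R$ (not necessarily with a density), and let $Y_j=X_j+\varepsilon_j$, $j=1,2,\dots$, where the $X_j$ are i.i.d. with law $F$, the $\varepsilon_j$ are i.i.d. with density $h$, and all these variables are independent; write $P_F$ for the probability. With the column vector $l^{*}_{(k)}(y)=\dot l_k(y;0)$ and $L_k=I_k(0)^{-1}$ let $$U_k=\Bigl(\tfrac1{\sqrt n}\sum_{j=1}^n l^{*}_{(k)}(Y_j)\Bigr)^{T}L_k\Bigl(\tfrac1{\sqrt n}\sum_{j=1}^n l^{*}_{(k)}(Y_j)\Bigr).$$ Let $\pi:\mathbb N\times\mathbb N\to\mathbb R$ be a penalty, that is, $\pi(1,n)<\dots<\pi(d,n)$ for all $n\ge1$ and $\pi(j,n)-\pi(1,n)\to\infty$ as $n\to\infty$ for $2\le j\le d$, and let $$S=\min\{k: 1\le k\le d,\ U_k-\pi(k,n)\ge U_j-\pi(j,n)\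 \text{for } j=1,\dots,d\}.$$ **Proposition.** Let $l^*_i$ be the $i$-th coordinate of $l^*=l^*_{(d)}$. Suppose that - $\langle D1\rangle$ $K$ is an integer, $1\le K\le d$, such that $l_1^*,\dots,l_K^*$ are integrable with respect to $F*h$ (the law of $Y_1$), $E_{F*h}\,l_i^*=0$ for $1\le i\le K-1$, and $E_{F*h}\,l_K^*\ne0$; - $\langle S1\rangle$ $\pi(k,n)=o(n)$ as $n\to\infty$ for every fixed $k\ge1$. Then, as $n\to\infty$, $P_F(S\ge K)\to1$, and $U_S\to\infty$ in probability, i.e. $P_F(U_S\le t)\to0$ for every $t\in\mathbb R$. -/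

import Mathlib

open MeasureTheory ProbabilityTheory Filter Topology Asymptotics
open scoped Matrix

noncomputable section

namespace SimpleDeconvolution

/-- `g` is a probability density on `ℝ` with respect to Lebesgue measure. -/
structure IsDensity (g : ℝ → ℝ) : Prop where
  measurable : Measurable g
  nonneg : ∀ x, 0 ≤ g x
  integral_eq_one : ∫ x, g x = 1

/-- `h` is a density of the noise: it has mean zero and finite positive second moment. -/
structure IsNoiseDensity (h : ℝ → ℝ) : Prop where
  isDensity : IsDensity h
  integrable_mul : Integrable fun x => x * h x
  mean_eq_zero : ∫ x, x * h x = 0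
  integrable_sq_mul : Integrable fun x => x ^ 2 * h x
  second_moment_pos : 0 < ∫ x, x ^ 2 * h x

/-- The measure with density `g` with respect to Lebesgue measure. -/
def densityMeasure (g : ℝ → ℝ) : Measure ℝ :=
  volume.withDensity fun x => ENNReal.ofReal (g x)

/-- A family `f θ` of functions on `ℝ`, `θ` in a parameter set `Θ` of `k`-dimensional
Euclidean space. (Only the values of `f` at `θ ∈ Θ` matter.) -/
structure ParamFamily (k : ℕ) where
  Θ : Set (EuclideanSpace ℝ (Fin k))
  f : EuclideanSpace ℝ (Fin k) → ℝ → ℝ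

namespace ParamFamily

variable {k : ℕ} (M : ParamFamily k) (h : ℝ → ℝ)

/-- The density `q (y ; θ) = ∫ f_θ(s) h(y - s) ds` of the observation. -/
def q (θ : EuclideanSpace ℝ (Fin k)) (y : ℝ) : ℝ :=
  ∫ s, M.f θ s * h (y - s)

/-- The distribution `Q_θ` of the observation. -/
def Q (θ : EuclideanSpace ℝ (Fin k)) : Measure ℝ :=
  densityMeasure (M.q h θ)

/-- The score function: the gradient of `q (y ; ·)` (on `Θ`) at `θ`, divided by `q (y ; θ)`,
where `q (y ; θ) > 0`, and zero elsewhere. -/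
def score (θ : EuclideanSpace ℝ (Fin k)) : ℝ → EuclideanSpace ℝ (Fin k) :=
  Set.indicator {y | 0 < M.q h θ y} fun y =>
    (M.q h θ y)⁻¹ • gradientWithin (fun θ' => M.q h θ' y) M.Θ θ

/-- The Fisher information matrix. -/
def fisher (θ : EuclideanSpace ℝ (Fin k)) : Matrix (Fin k) (Fin k) ℝ :=
  Matrix.of fun i j => ∫ y, M.score h θ y i * M.score h θ y j ∂(M.Q h θ)

/-- The family gives a regular deconvolution problem. -/
structure IsRegular : Prop where
  contDiff : ∀ θ ∈ M.Θ, ∀ᵐ y, ContDiffWithinAt ℝ 1 (fun θ' => M.q h θ' y) M.Θ θ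
  memLp_score : ∀ θ ∈ M.Θ, MemLp (M.score h θ) 2 (M.Q h θ)
  fisher_nonsingular : ∀ θ ∈ M.Θ, IsUnit (M.fisher h θ)
  fisher_continuous : ContinuousOn (M.fisher h) M.Θ

/-- The efficient score vector for testing `θ = 0`. -/
def effScore : ℝ → EuclideanSpace ℝ (Fin k) := M.score h 0

/-- The matrix `L`: the inverse of the second moment matrix of the efficient score under the
null hypothesis. -/
def L : Matrix (Fin k) (Fin k) ℝ :=
  (Matrix.of fun i j => ∫ y, M.effScore h y i * M.effScore h y j ∂(M.Q h 0))⁻¹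

/-- The score test statistic `U_k` computed from the first `n` terms of the sequence `y`. -/
def U (n : ℕ) (y : ℕ → ℝ) : ℝ :=
  let v : Fin k → ℝ := fun i => (1 / √(n : ℝ)) * ∑ j ∈ Finset.range n, M.effScore h (y j) i
  v ⬝ᵥ (M.L h *ᵥ v)

end ParamFamily

/-- Extension of a vector by zeros (the inclusion of `ℝ^k` in `ℝ^l`, for `k ≤ l`). -/
def padZero (k l : ℕ) (θ : EuclideanSpace ℝ (Fin k)) : EuclideanSpace ℝ (Fin l) :=
  WithLp.toLp 2 fun i => if hi : (i : ℕ) < k then θ ⟨i, hi⟩ else 0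

/-- A nested sequence of parametric families of densities, of dimensions `1, …, d`, all
containing the null density `f₀` as the member with parameter `0`. -/
structure IsNested (d : ℕ) (f₀ : ℝ → ℝ) (M : ∀ k, ParamFamily k) : Prop where
  isDensity : ∀ k, 1 ≤ k → k ≤ d → ∀ θ ∈ (M k).Θ, IsDensity ((M k).f θ)
  /-- Derivatives relative to the parameter set are unique; every open set has this property. -/
  uniqueDiffOn : ∀ k, 1 ≤ k → k ≤ d → UniqueDiffOn ℝ (M k).Θ
  zero_mem : ∀ k, 1 ≤ k → k ≤ d → (0 : EuclideanSpace ℝ (Fin k)) ∈ (M k).Θ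
  f_zero : ∀ k, 1 ≤ k → k ≤ d → (M k).f 0 =ᵐ[volume] f₀
  subset : ∀ k l, 1 ≤ k → k ≤ l → l ≤ d → ∀ θ ∈ (M k).Θ, padZero k l θ ∈ (M l).Θ
  f_eq : ∀ k l, 1 ≤ k → k ≤ l → l ≤ d → ∀ θ ∈ (M k).Θ,
    (M l).f (padZero k l θ) =ᵐ[volume] (M k).f θ

/-- `π k n` is the penalty attributed to the `k`-th model and the sample size `n`. -/
structure IsPenalty (d : ℕ) (π : ℕ → ℕ → ℝ) : Prop where
  strictMono : ∀ n, 1 ≤ n → ∀ i j, 1 ≤ i → i < j → j ≤ d → π i n < π j n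
  tendsto : ∀ j, 2 ≤ j → j ≤ d → Tendsto (fun n => π j n - π 1 n) atTop atTop

/-- The selection rule `S`, computed from the first `n` terms of the sequence `y`. -/
def selection (d : ℕ) (M : ∀ k, ParamFamily k) (h : ℝ → ℝ) (π : ℕ → ℕ → ℝ)
    (n : ℕ) (y : ℕ → ℝ) : ℕ :=
  sInf {k | 1 ≤ k ∧ k ≤ d ∧ ∀ j, 1 ≤ j → j ≤ d →
    (M j).U h n y - π j n ≤ (M k).U h n y - π k n}

/-- The data-driven statistic `U_S`. -/
def dataDrivenU (d : ℕ) (M : ∀ k, ParamFamily k) (h : ℝ → ℝ) (π : ℕ → ℕ → ℝ)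
    (n : ℕ) (y : ℕ → ℝ) : ℝ :=
  (M (selection d M h π n y)).U h n y

/-- The integer `K`, `1 ≤ K ≤ d`, is the first index for which the coordinate of the efficient
score has nonzero expectation when `X` has law `F`, i.e. with respect to `F ∗ h`; the
expectations up to index `K` exist. The coordinate with index `i : Fin d` is the `(i + 1)`-th. -/
structure ConditionD1 (d : ℕ) (M : ParamFamily d) (h : ℝ → ℝ) (F : Measure ℝ) (K : ℕ) :
    Prop where
  one_le : 1 ≤ K
  le_d : K ≤ d
  integrable : ∀ i : Fin d, (i : ℕ) + 1 ≤ K →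
    Integrable (fun y => M.effScore h y i) (F.conv (densityMeasure h))
  eq_zero : ∀ i : Fin d, (i : ℕ) + 1 < K →
    ∫ y, M.effScore h y i ∂(F.conv (densityMeasure h)) = 0
  ne_zero : ∀ i : Fin d, (i : ℕ) + 1 = K →
    ∫ y, M.effScore h y i ∂(F.conv (densityMeasure h)) ≠ 0

/-- `X 0, X 1, …` are i.i.d. with law `F`, the errors `ε 0, ε 1, …` are i.i.d. with density `h`,
and all these variables are independent. -/
structure IsSample {Ω : Type*} [MeasurableSpace Ω] (P : Measure Ω) (F : Measure ℝ) (h : ℝ → ℝ)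
    (X ε : ℕ → Ω → ℝ) : Prop where
  law_X : ∀ i, HasLaw (X i) F P
  law_ε : ∀ i, HasLaw (ε i) (densityMeasure h) P
  indep_pair : ∀ i, IndepFun (X i) (ε i) P
  iIndep : iIndepFun (fun i ω => (X i ω, ε i ω)) P

end SimpleDeconvolution

end

namespace SimpleDeconvolution

/-! By the strong law, the averaged scores of model `k ≤ K` converge almost surely to their mean
`m_k` under `F ∗ h`, so `U_k / n` tends to `m_kᵀ L_k m_k`. Nestedness makes the score of model `k`
the first `k` coordinates of `l*` Lebesgue-a.e. (`IsNested.effScore_ae_eq`), hence `F ∗ h`-a.e.; so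
`m_k = 0` for `k < K`, while `m_K ≠ 0` and positive definiteness of `L_K` make the limit for `K`
positive (`ae_tendsto_U_div`).

Since penalties are `o(n)`, model `K` eventually beats every smaller one, which forces `S ≥ K`.
Maximality at `S` and monotone penalties then give `U_S ≥ U_K → ∞`. Nothing is needed about the
scores of models above `K`. -/

/-! ### Scores of nested families -/

/-- Extension by zeros as a continuous linear map. -/
noncomputable def padZeroCLM (k l : ℕ) : EuclideanSpace ℝ (Fin k) →L[ℝ] EuclideanSpace ℝ (Fin l) :=
  LinearMap.toContinuousLinearMap
    { toFun := padZero k l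
      map_add' := fun x y => by
        ext i
        by_cases hi : (i : ℕ) < k <;> simp [padZero, hi]
      map_smul' := fun c x => by
        ext i
        by_cases hi : (i : ℕ) < k <;> simp [padZero, hi] }

theorem padZeroCLM_apply (k l : ℕ) (θ : EuclideanSpace ℝ (Fin k)) :
    padZeroCLM k l θ = padZero k l θ := rfl

theorem padZero_single {k l : ℕ} (hkl : k ≤ l) (i : Fin k) :
    padZero k l (EuclideanSpace.single i 1) = EuclideanSpace.single (Fin.castLE hkl i) 1 := by
  ext j
  by_cases hj : (j : ℕ) < k
  · simp [padZero, hj, Fin.ext_iff]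
  · have : j ≠ Fin.castLE hkl i := fun h => hj (by rw [h]; exact i.2)
    simp [padZero, hj, this]

theorem gradientWithin_apply {k : ℕ} (g : EuclideanSpace ℝ (Fin k) → ℝ)
    (s : Set (EuclideanSpace ℝ (Fin k))) (θ : EuclideanSpace ℝ (Fin k)) (i : Fin k) :
    gradientWithin g s θ i = fderivWithin ℝ g s θ (EuclideanSpace.single i 1) := by
  rw [gradientWithin, ← InnerProductSpace.toDual_symm_apply, real_inner_comm,
    EuclideanSpace.inner_single_left]
  simp

theorem IsNested.q_padZero {d : ℕ} {f₀ : ℝ → ℝ} {M : ∀ k, ParamFamily k} (hM : IsNested d f₀ M)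
    (h : ℝ → ℝ) {k l : ℕ} (hk : 1 ≤ k) (hkl : k ≤ l) (hl : l ≤ d)
    {θ : EuclideanSpace ℝ (Fin k)} (hθ : θ ∈ (M k).Θ) (y : ℝ) :
    (M l).q h (padZero k l θ) y = (M k).q h θ y := by
  refine integral_congr_ae ?_
  filter_upwards [hM.f_eq k l hk hkl hl θ hθ] with s hs
  rw [hs]

/-- The coordinates of the efficient scores of nested families agree almost everywhere. -/
theorem IsNested.effScore_ae_eq {d : ℕ} {f₀ : ℝ → ℝ} {M : ∀ k, ParamFamily k}
    (hM : IsNested d f₀ M) {h : ℝ → ℝ} {k l : ℕ} (hk : 1 ≤ k) (hkl : k ≤ l) (hl : l ≤ d)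
    (hreg : (M l).IsRegular h) (i : Fin k) :
    (fun y => (M k).effScore h y i) =ᵐ[volume] fun y => (M l).effScore h y (Fin.castLE hkl i) := by
  have h0k := hM.zero_mem k hk (hkl.trans hl)
  have h0 : padZeroCLM k l 0 = 0 := map_zero _
  filter_upwards [hreg.contDiff 0 (hM.zero_mem l (hk.trans hkl) hl)] with y hy
  have hq0 : (M l).q h 0 y = (M k).q h 0 y := by
    rw [← hM.q_padZero h hk hkl hl h0k y, ← padZeroCLM_apply, h0]
  have hdiff : HasFDerivWithinAt (fun θ' => (M l).q h θ' y)
      (fderivWithin ℝ (fun θ' => (M l).q h θ' y) (M l).Θ 0) (M l).Θ (padZeroCLM k l 0) := by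
    rw [h0]
    exact (hy.differentiableWithinAt one_ne_zero).hasFDerivWithinAt
  -- Chain rule along the inclusion of parameter sets; unique differentiability then identifies this
  -- derivative with the one defining the smaller score.
  have hcomp : HasFDerivWithinAt (fun θ' => (M k).q h θ' y)
      ((fderivWithin ℝ (fun θ' => (M l).q h θ' y) (M l).Θ 0).comp (padZeroCLM k l))
      (M k).Θ 0 := by
    refine (hdiff.comp 0 (padZeroCLM k l).hasFDerivWithinAt
      (fun θ hθ => hM.subset k l hk hkl hl θ hθ)).congr (fun θ hθ => ?_) ?_
    · exact (hM.q_padZero h hk hkl hl hθ y).symm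
    · exact (hM.q_padZero h hk hkl hl h0k y).symm
  have hgrad : gradientWithin (fun θ' => (M k).q h θ' y) (M k).Θ 0 i
      = gradientWithin (fun θ' => (M l).q h θ' y) (M l).Θ 0 (Fin.castLE hkl i) := by
    rw [gradientWithin_apply, gradientWithin_apply,
      hcomp.fderivWithin (hM.uniqueDiffOn k hk (hkl.trans hl) 0 h0k),
      ContinuousLinearMap.comp_apply, padZeroCLM_apply, padZero_single hkl]
  by_cases hpos : 0 < (M k).q h 0 y
  · have hpos' : 0 < (M l).q h 0 y := hq0 ▸ hpos
    simp [ParamFamily.effScore, ParamFamily.score, Set.indicator, hpos, hgrad, hq0]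
  · have hpos' : ¬ 0 < (M l).q h 0 y := hq0 ▸ hpos
    simp [ParamFamily.effScore, ParamFamily.score, Set.indicator, hpos, hpos']

/-! ### The score statistic as a quadratic form -/

/-- The matrix of second moments of a square integrable random vector is positive semidefinite. -/
theorem posSemidef_secondMoment {α : Type*} [MeasurableSpace α] {μ : Measure α} {k : ℕ}
    {s : α → EuclideanSpace ℝ (Fin k)} (hs : MemLp s 2 μ) :
    (Matrix.of fun i j => ∫ y, s y i * s y j ∂μ).PosSemidef := by
  have hi : ∀ i, MemLp (fun y => s y i) 2 μ := fun i =>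
    (EuclideanSpace.proj i : EuclideanSpace ℝ (Fin k) →L[ℝ] ℝ).comp_memLp' hs
  have hij : ∀ i j, Integrable (fun y => s y i * s y j) μ := fun i j =>
    (hi i).integrable_mul (hi j)
  refine .of_dotProduct_mulVec_nonneg ?_ fun x => ?_
  · ext i j
    simp [mul_comm]
  -- The quadratic form at `x` is the second moment of the linear form `∑ i, x i * s y i`.
  · have key : star x ⬝ᵥ ((Matrix.of fun i j => ∫ y, s y i * s y j ∂μ) *ᵥ x)
        = ∫ y, (∑ i, x i * s y i) ^ 2 ∂μ := by
      have : ∀ y, (∑ i, x i * s y i) ^ 2 = ∑ i, ∑ j, x i * x j * (s y i * s y j) := fun y => by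
        rw [sq, Finset.sum_mul_sum]
        exact Finset.sum_congr rfl fun i _ => Finset.sum_congr rfl fun j _ => by ring
      simp_rw [this]
      rw [integral_finsetSum _ fun i _ => integrable_finsetSum _ fun j _ => (hij i j).const_mul _]
      refine Finset.sum_congr rfl fun i _ => ?_
      rw [integral_finsetSum _ fun j _ => (hij i j).const_mul _, Matrix.mulVec, dotProduct,
        Finset.mul_sum]
      refine Finset.sum_congr rfl fun j _ => ?_
      rw [integral_const_mul, Matrix.of_apply, star_trivial]
      ring
    rw [key]
    exact integral_nonneg fun y => sq_nonneg _

/-- A positive semidefinite nonsingular matrix is positive definite, and so is its inverse. -/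
theorem ParamFamily.IsRegular.posDef_L {k : ℕ} {M : ParamFamily k} {h : ℝ → ℝ}
    (hreg : M.IsRegular h) (h0 : (0 : EuclideanSpace ℝ (Fin k)) ∈ M.Θ) : (M.L h).PosDef := by
  have hpos : (M.fisher h 0).PosDef :=
    (posSemidef_secondMoment (hreg.memLp_score 0 h0)).posDef_iff_isUnit.2
      (hreg.fisher_nonsingular 0 h0)
  exact hpos.inv

/-- The score statistic, divided by the sample size, is the quadratic form of the means. -/
theorem ParamFamily.U_div {k : ℕ} (M : ParamFamily k) (h : ℝ → ℝ) (n : ℕ) (y : ℕ → ℝ) :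
    M.U h n y / n = (fun i => (∑ j ∈ Finset.range n, M.effScore h (y j) i) / n) ⬝ᵥ
      (M.L h *ᵥ fun i => (∑ j ∈ Finset.range n, M.effScore h (y j) i) / n) := by
  have h1 : (fun i => (∑ j ∈ Finset.range n, M.effScore h (y j) i) / (n : ℝ))
      = (1 / √(n : ℝ)) • fun i => (1 / √(n : ℝ)) * ∑ j ∈ Finset.range n, M.effScore h (y j) i := by
    ext i
    rw [Pi.smul_apply, smul_eq_mul, ← mul_assoc, div_mul_div_comm, Real.mul_self_sqrt n.cast_nonneg]
    ring
  rw [h1, Matrix.mulVec_smul, smul_dotProduct, dotProduct_smul, smul_smul, div_mul_div_comm,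
    Real.mul_self_sqrt n.cast_nonneg, ParamFamily.U, smul_eq_mul]
  ring

theorem ParamFamily.tendsto_U_div {k : ℕ} (M : ParamFamily k) (h : ℝ → ℝ) {y : ℕ → ℝ}
    {m : Fin k → ℝ}
    (hm : ∀ i, Tendsto (fun n : ℕ => (∑ j ∈ Finset.range n, M.effScore h (y j) i) / (n : ℝ))
      atTop (𝓝 (m i))) :
    Tendsto (fun n : ℕ => M.U h n y / n) atTop (𝓝 (m ⬝ᵥ (M.L h *ᵥ m))) := by
  simp_rw [M.U_div]
  have hcont : Continuous fun v : Fin k → ℝ => v ⬝ᵥ (M.L h *ᵥ v) := by fun_prop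
  exact (hcont.tendsto m).comp (tendsto_pi_nhds.2 hm)

/-- The selected dimension maximizes the penalized statistic. -/
theorem selection_mem {d : ℕ} (hd : 1 ≤ d) (M : ∀ k, ParamFamily k) (h : ℝ → ℝ)
    (π : ℕ → ℕ → ℝ) (n : ℕ) (y : ℕ → ℝ) :
    1 ≤ selection d M h π n y ∧ selection d M h π n y ≤ d ∧ ∀ j, 1 ≤ j → j ≤ d →
      (M j).U h n y - π j n ≤
        (M (selection d M h π n y)).U h n y - π (selection d M h π n y) n := by
  have hne : {k | 1 ≤ k ∧ k ≤ d ∧ ∀ j, 1 ≤ j → j ≤ d →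
      (M j).U h n y - π j n ≤ (M k).U h n y - π k n}.Nonempty := by
    obtain ⟨k, hk, hmax⟩ := Finset.exists_max_image (Finset.Icc 1 d)
      (fun k => (M k).U h n y - π k n) ⟨1, Finset.mem_Icc.2 ⟨le_rfl, hd⟩⟩
    rw [Finset.mem_Icc] at hk
    exact ⟨k, hk.1, hk.2, fun j h1 hj => hmax j (Finset.mem_Icc.2 ⟨h1, hj⟩)⟩
  exact Nat.sInf_mem hne

/-! ### Limit theorems and the law of the observations -/

/-- The strong law of large numbers for an integrable function of pairwise independent
variables with a common law. -/
theorem ae_tendsto_mean {Ω : Type*} [MeasurableSpace Ω] {P : Measure Ω} {μ : Measure ℝ}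
    {Y : ℕ → Ω → ℝ} (hlaw : ∀ j, HasLaw (Y j) μ P)
    (hindep : Pairwise fun i j => IndepFun (Y i) (Y j) P) {g : ℝ → ℝ} (hg : Integrable g μ) :
    ∀ᵐ ω ∂P, Tendsto (fun n : ℕ => (∑ j ∈ Finset.range n, g (Y j ω)) / (n : ℝ)) atTop
      (𝓝 (∫ y, g y ∂μ)) := by
  have hgm : ∀ j, AEMeasurable g (P.map (Y j)) := fun j => by
    rw [(hlaw j).map_eq]
    exact hg.aemeasurable
  have key := strong_law_ae_real (μ := P) (fun j ω => g (Y j ω))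
    (by
      have h1 : Integrable g (P.map (Y 0)) := by rwa [(hlaw 0).map_eq]
      exact h1.comp_aemeasurable (hlaw 0).aemeasurable)
    (fun i j hij => (hindep hij).comp₀ (hlaw i).aemeasurable (hlaw j).aemeasurable (hgm i) (hgm j))
    (fun i => IdentDistrib.comp_of_aemeasurable
      ⟨(hlaw i).aemeasurable, (hlaw 0).aemeasurable,
        (hlaw i).map_eq.trans (hlaw 0).map_eq.symm⟩ (hgm i))
  rwa [show ∫ ω, g (Y 0 ω) ∂P = ∫ y, g y ∂μ from
    (hlaw 0).integral_comp hg.aestronglyMeasurable] at key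

/-- If almost every point belongs to only finitely many of the sets `B n`, their measures tend
to zero. -/
theorem tendsto_measure_of_ae_eventually_notMem {Ω : Type*} [MeasurableSpace Ω] {P : Measure Ω}
    [IsFiniteMeasure P] {B : ℕ → Set Ω} (hB : ∀ n, NullMeasurableSet (B n) P)
    (h : ∀ᵐ ω ∂P, ∀ᶠ n in atTop, ω ∉ B n) :
    Tendsto (fun n => P (B n)) atTop (𝓝 0) := by
  -- The tail unions decrease to the limsup of the sets, which is null; continuity from above
  -- applies.
  have hanti : Antitone fun n => ⋃ m ≥ n, B m := fun a b hab =>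
    Set.biUnion_subset_biUnion_left fun m hm => le_trans hab hm
  have hlim := tendsto_measure_iInter_atTop (μ := P) (s := fun n => ⋃ m ≥ n, B m)
    (fun n => .iUnion fun m => .iUnion fun _ => hB m) hanti ⟨0, measure_ne_top _ _⟩
  have hzero : P (⋂ n, ⋃ m ≥ n, B m) = 0 := by
    refine measure_mono_null (fun ω hω => ?_) (ae_iff.1 h)
    simp only [Set.mem_iInter, Set.mem_iUnion] at hω
    simp only [Set.mem_ofPred_eq, eventually_atTop, not_exists, not_forall, not_not]
    intro n
    obtain ⟨m, hm, hmB⟩ := hω n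
    exact ⟨m, hm, hmB⟩
  rw [hzero] at hlim
  exact tendsto_of_tendsto_of_tendsto_of_le_of_le tendsto_const_nhds hlim (fun _ => zero_le)
    fun n => measure_mono (Set.subset_biUnion_of_mem (u := B) (show n ≥ n from le_rfl))

theorem IsSample.hasLaw_add {Ω : Type*} [MeasurableSpace Ω] {P : Measure Ω}
    [IsProbabilityMeasure P] {F : Measure ℝ} [IsProbabilityMeasure F] {h : ℝ → ℝ}
    {X ε : ℕ → Ω → ℝ} (hs : IsSample P F h X ε) (j : ℕ) :
    HasLaw (fun ω => X j ω + ε j ω) (F.conv (densityMeasure h)) P := by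
  have : IsProbabilityMeasure (densityMeasure h) :=
    (hs.law_ε j).isProbabilityMeasure_iff.1 inferInstance
  exact (hs.indep_pair j).hasLaw_add (hs.law_X j) (hs.law_ε j)

theorem IsSample.indepFun_add {Ω : Type*} [MeasurableSpace Ω] {P : Measure Ω} {F : Measure ℝ}
    {h : ℝ → ℝ} {X ε : ℕ → Ω → ℝ} (hs : IsSample P F h X ε) :
    Pairwise fun i j => IndepFun (fun ω => X i ω + ε i ω) (fun ω => X j ω + ε j ω) P :=
  fun _ _ hij => (hs.iIndep.indepFun hij).comp (measurable_fst.add measurable_snd)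
    (measurable_fst.add measurable_snd)

/-- Translates of Lebesgue-null sets are null, so convolving with the noise suffices even when `F`
has no density. This lets Lebesgue-a.e. identities of scores be used under the law of the
observations. -/
theorem conv_densityMeasure_absolutelyContinuous (F : Measure ℝ) (h : ℝ → ℝ) :
    F.conv (densityMeasure h) ≪ volume := by
  have : SFinite (densityMeasure h) := by
    rw [densityMeasure]
    infer_instance
  exact Measure.conv_absolutelyContinuous (withDensity_absolutelyContinuous _ _)

theorem ParamFamily.aemeasurable_U {Ω : Type*} [MeasurableSpace Ω] {P : Measure Ω} {μ : Measure ℝ}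
    {Y : ℕ → Ω → ℝ} (hlaw : ∀ j, HasLaw (Y j) μ P) {k : ℕ} (M : ParamFamily k) (h : ℝ → ℝ)
    (hM : ∀ i, AEMeasurable (fun y => M.effScore h y i) μ) (n : ℕ) :
    AEMeasurable (fun ω => M.U h n fun j => Y j ω) P := by
  have hi : ∀ i j, AEMeasurable (fun ω => M.effScore h (Y j ω) i) P := fun i j =>
    AEMeasurable.comp_aemeasurable (g := fun y => M.effScore h y i)
      (by rw [(hlaw j).map_eq]; exact hM i) (hlaw j).aemeasurable
  have hv : AEMeasurable (fun ω => fun i =>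
      (1 / √(n : ℝ)) * ∑ j ∈ Finset.range n, M.effScore h (Y j ω) i) P :=
    aemeasurable_pi_lambda _ fun i =>
      (Finset.aemeasurable_fun_sum _ fun j _ => hi i j).const_mul _
  have hcont : Continuous fun v : Fin k → ℝ => v ⬝ᵥ (M.L h *ᵥ v) := by fun_prop
  exact hcont.measurable.comp_aemeasurable hv

/-- Condition D1 speaks only of the largest family; this carries it down to the smaller ones. -/
theorem IsNested.integrable_effScore {d : ℕ} {f₀ : ℝ → ℝ} {M : ∀ k, ParamFamily k}
    (hM : IsNested d f₀ M) {h : ℝ → ℝ} (hreg : (M d).IsRegular h) {F : Measure ℝ} {K : ℕ}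
    (hD1 : ConditionD1 d (M d) h F K) {k : ℕ} (hk : 1 ≤ k) (hkK : k ≤ K) (i : Fin k) :
    Integrable (fun y => (M k).effScore h y i) (F.conv (densityMeasure h)) ∧
      ∫ y, (M k).effScore h y i ∂(F.conv (densityMeasure h)) =
        ∫ y, (M d).effScore h y (Fin.castLE (hkK.trans hD1.le_d) i)
          ∂(F.conv (densityMeasure h)) := by
  have hae := (conv_densityMeasure_absolutelyContinuous F h).ae_eq
    (hM.effScore_ae_eq hk (hkK.trans hD1.le_d) le_rfl hreg i)
  exact ⟨(hD1.integrable _ (le_trans i.2 hkK)).congr hae.symm, integral_congr_ae hae⟩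

/-! ### Growth of the statistics and consistency -/

/-- The deterministic part of the consistency argument: the penalized statistic of a model with
a positive limit of `U / n` eventually dominates. -/
theorem eventually_penalized_lt {u v p r : ℕ → ℝ} {c : ℝ} (hc : 0 < c)
    (hu : Tendsto (fun n : ℕ => u n / n) atTop (𝓝 0))
    (hv : Tendsto (fun n : ℕ => v n / n) atTop (𝓝 c))
    (hp : p =o[atTop] fun n : ℕ => (n : ℝ)) (hr : r =o[atTop] fun n : ℕ => (n : ℝ)) :
    ∀ᶠ n in atTop, u n - p n < v n - r n := by
  have h1 := hu.sub hp.tendsto_div_nhds_zero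
  have h2 := hv.sub hr.tendsto_div_nhds_zero
  have hlt := h1.eventually_lt h2 (by simpa using hc)
  filter_upwards [hlt, eventually_gt_atTop 0] with n hn hn0
  rw [← sub_div, ← sub_div] at hn
  exact (div_lt_div_iff_of_pos_right (by exact_mod_cast hn0)).1 hn

theorem eventually_gt_of_tendsto_div {v : ℕ → ℝ} {c : ℝ} (hc : 0 < c)
    (hv : Tendsto (fun n : ℕ => v n / n) atTop (𝓝 c)) (t : ℝ) : ∀ᶠ n in atTop, t < v n := by
  -- The constant `t` plays the losing statistic, with zero penalties.
  have h := eventually_penalized_lt (u := fun _ => t) (p := 0) (r := 0) hc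
    (tendsto_const_div_atTop_nhds_zero_nat t) hv (isLittleO_zero _ _) (isLittleO_zero _ _)
  simpa using h

/-- Almost surely, `U_k / n → 0` for `k < K`, and `U_K / n` has a positive limit. -/
theorem ae_tendsto_U_div {Ω : Type*} [MeasurableSpace Ω] {P : Measure Ω}
    [IsProbabilityMeasure P] {h f₀ : ℝ → ℝ} {d : ℕ} {M : ∀ k, ParamFamily k}
    (hM : IsNested d f₀ M) (hreg : ∀ k, 1 ≤ k → k ≤ d → (M k).IsRegular h)
    {F : Measure ℝ} [IsProbabilityMeasure F] {X ε : ℕ → Ω → ℝ} (hs : IsSample P F h X ε)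
    {K : ℕ} (hD1 : ConditionD1 d (M d) h F K) :
    ∃ c : ℝ, 0 < c ∧ ∀ᵐ ω ∂P,
      (∀ k, 1 ≤ k → k < K →
        Tendsto (fun n : ℕ => (M k).U h n (fun j => X j ω + ε j ω) / n) atTop (𝓝 0)) ∧
      Tendsto (fun n : ℕ => (M K).U h n (fun j => X j ω + ε j ω) / n) atTop (𝓝 c) := by
  have hregd := hreg d (hD1.one_le.trans hD1.le_d) le_rfl
  set μ := F.conv (densityMeasure h) with hμ
  have hlim : ∀ᵐ ω ∂P, ∀ k, 1 ≤ k → k ≤ K → ∀ i : Fin k,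
      Tendsto (fun n : ℕ =>
        (∑ j ∈ Finset.range n, (M k).effScore h (X j ω + ε j ω) i) / (n : ℝ)) atTop
        (𝓝 (∫ y, (M k).effScore h y i ∂μ)) := by
    -- The bounds on `k` are propositions, hence finite index types for `eventually_all`.
    refine ae_all_iff.2 fun k => eventually_all.2 fun hk => eventually_all.2 fun hkK =>
      ae_all_iff.2 fun i => ?_
    exact ae_tendsto_mean hs.hasLaw_add hs.indepFun_add
      (hM.integrable_effScore hregd hD1 hk hkK i).1
  refine ⟨(fun i => ∫ y, (M K).effScore h y i ∂μ) ⬝ᵥ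
    ((M K).L h *ᵥ fun i => ∫ y, (M K).effScore h y i ∂μ), ?_, ?_⟩
  · have hpos := (hreg K hD1.one_le hD1.le_d).posDef_L (hM.zero_mem K hD1.one_le hD1.le_d)
    have hne : (fun i => ∫ y, (M K).effScore h y i ∂μ) ≠ 0 := fun h0 => by
      -- Coordinates are indexed from zero, so the `K`-th one has index `K - 1`.
      have hlt : K - 1 < K := Nat.sub_lt hD1.one_le one_pos
      have h1 := congrFun h0 ⟨K - 1, hlt⟩
      rw [(hM.integrable_effScore hregd hD1 hD1.one_le le_rfl _).2] at h1
      exact hD1.ne_zero _ (Nat.sub_add_cancel hD1.one_le) h1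
    simpa using hpos.dotProduct_mulVec_pos hne
  · filter_upwards [hlim] with ω hω
    refine ⟨fun k hk hkK => ?_, (M K).tendsto_U_div h (hω K hD1.one_le le_rfl)⟩
    have h0 := (M k).tendsto_U_div h (hω k hk hkK.le)
    have hz : (fun i => ∫ y, (M k).effScore h y i ∂μ) = 0 := by
      ext i
      rw [(hM.integrable_effScore hregd hD1 hk hkK.le i).2]
      exact hD1.eq_zero _ (by simpa using lt_of_le_of_lt (Nat.succ_le_of_lt i.2) hkK)
    rwa [hz, zero_dotProduct] at h0

end SimpleDeconvolution

theorem mainTheorem7 {Ω : Type*} [MeasurableSpace Ω] (P : Measure Ω) [IsProbabilityMeasure P]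
    (h f₀ : ℝ → ℝ) (hh : SimpleDeconvolution.IsNoiseDensity h)
    (hf₀ : SimpleDeconvolution.IsDensity f₀)
    (d : ℕ) (M : ∀ k, SimpleDeconvolution.ParamFamily k)
    (hM : SimpleDeconvolution.IsNested d f₀ M)
    (hreg : ∀ k, 1 ≤ k → k ≤ d → (M k).IsRegular h)
    (π : ℕ → ℕ → ℝ) (hπ : SimpleDeconvolution.IsPenalty d π)
    (F : Measure ℝ) [IsProbabilityMeasure F]
    (X ε : ℕ → Ω → ℝ) (hsample : SimpleDeconvolution.IsSample P F h X ε)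
    (K : ℕ) (hD1 : SimpleDeconvolution.ConditionD1 d (M d) h F K)
    (hS1 : ∀ k, 1 ≤ k → (fun n : ℕ => π k n) =o[atTop] fun n : ℕ => (n : ℝ)) :
    Tendsto (fun n : ℕ =>
        P {ω | K ≤ SimpleDeconvolution.selection d M h π n (fun j => X j ω + ε j ω)})
      atTop (𝓝 1) ∧
    ∀ t : ℝ, Tendsto (fun n : ℕ =>
        P {ω | SimpleDeconvolution.dataDrivenU d M h π n (fun j => X j ω + ε j ω) ≤ t})
      atTop (𝓝 0) := by
  have hd : 1 ≤ d := hD1.one_le.trans hD1.le_d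
  let Y : Ω → ℕ → ℝ := fun ω j => X j ω + ε j ω
  -- The bad event involves only models up to `K`, whose statistics are a.e. measurable; the events
  -- in the theorem are compared with it by monotonicity alone.
  let B : ℝ → ℕ → Set Ω := fun t n =>
    (⋃ k ∈ Finset.Ico 1 K, {ω | (M K).U h n (Y ω) - π K n ≤ (M k).U h n (Y ω) - π k n}) ∪
      {ω | (M K).U h n (Y ω) ≤ t}
  have hUm : ∀ k, 1 ≤ k → k ≤ K → ∀ n, AEMeasurable (fun ω => (M k).U h n (Y ω)) P :=
    fun k hk hkK n => SimpleDeconvolution.ParamFamily.aemeasurable_U hsample.hasLaw_add (M k) h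
      (fun i => (hM.integrable_effScore (hreg d hd le_rfl) hD1 hk hkK i).1.aemeasurable) n
  have hBm : ∀ t n, NullMeasurableSet (B t n) P := fun t n => by
    refine .union (Finset.nullMeasurableSet_biUnion _ fun k hk => ?_)
      (nullMeasurableSet_le (hUm K hD1.one_le le_rfl n) aemeasurable_const)
    rw [Finset.mem_Ico] at hk
    exact nullMeasurableSet_le ((hUm K hD1.one_le le_rfl n).sub_const _)
      ((hUm k hk.1 hk.2.le n).sub_const _)
  have hB0 : ∀ t, Tendsto (fun n => P (B t n)) atTop (𝓝 0) := fun t => by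
    refine SimpleDeconvolution.tendsto_measure_of_ae_eventually_notMem (hBm t) ?_
    obtain ⟨c, hc, hlim⟩ := SimpleDeconvolution.ae_tendsto_U_div hM hreg hsample hD1
    filter_upwards [hlim] with ω hω
    have h1 : ∀ᶠ n in atTop, ∀ k ∈ Finset.Ico 1 K,
        (M k).U h n (Y ω) - π k n < (M K).U h n (Y ω) - π K n := by
      refine (Filter.eventually_all_finset _).2 fun k hk => ?_
      rw [Finset.mem_Ico] at hk
      exact SimpleDeconvolution.eventually_penalized_lt hc (hω.1 k hk.1 hk.2) hω.2
        (hS1 k hk.1) (hS1 K hD1.one_le)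
    filter_upwards [h1, SimpleDeconvolution.eventually_gt_of_tendsto_div hc hω.2 t] with n hn1 hn2
    simp only [B, Set.mem_union, Set.mem_iUnion, Set.mem_ofPred_eq, not_or, not_exists, not_le]
    exact ⟨hn1, hn2⟩
  have hgood : ∀ t n ω, ω ∉ B t n → K ≤ SimpleDeconvolution.selection d M h π n (Y ω) :=
   fun t n ω hω => by
    by_contra! hlt
    obtain ⟨h1, -, hmax⟩ := SimpleDeconvolution.selection_mem hd M h π n (Y ω)
    exact hω (.inl (Set.mem_biUnion (Finset.mem_coe.2 (Finset.mem_Ico.2 ⟨h1, hlt⟩))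
      (hmax K hD1.one_le hD1.le_d)))
  constructor
  -- The level `0` is arbitrary: any `t` would do here.
  · have hcompl : Tendsto (fun n => P (B 0 n)ᶜ) atTop (𝓝 1) := by
      have h1 : ∀ n, P (B 0 n)ᶜ = 1 - P (B 0 n) := fun n => by
        rw [measure_compl₀ (hBm 0 n) (measure_ne_top _ _), measure_univ]
      simp_rw [h1]
      simpa using ENNReal.Tendsto.sub tendsto_const_nhds (hB0 0) (.inl ENNReal.one_ne_top)
    exact tendsto_of_tendsto_of_tendsto_of_le_of_le hcompl tendsto_const_nhds
      (fun n => measure_mono fun ω hω => hgood 0 n ω hω) fun n => prob_le_one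
  · intro t
    refine tendsto_of_tendsto_of_tendsto_of_le_of_le' tendsto_const_nhds (hB0 t)
      (.of_forall fun _ => zero_le) ?_
    -- Penalties are ordered only for `n ≥ 1`.
    filter_upwards [eventually_ge_atTop 1] with n hn
    refine measure_mono fun ω hω => ?_
    by_contra hnot
    have hK := hgood t n ω hnot
    obtain ⟨-, hSd, hmax⟩ := SimpleDeconvolution.selection_mem hd M h π n (Y ω)
    have hle := hmax K hD1.one_le hD1.le_d
    have hpen : π K n ≤ π (SimpleDeconvolution.selection d M h π n (Y ω)) n := by
      rcases hK.eq_or_lt with heq | hlt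
      · rw [← heq]
      · exact (hπ.strictMono n hn _ _ hD1.one_le hlt hSd).le
    have hU : (M (SimpleDeconvolution.selection d M h π n (Y ω))).U h n (Y ω) ≤ t := hω
    exact hnot (.inr (show (M K).U h n (Y ω) ≤ t by linarith))
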